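/- Let $S$ be a semigroup whose set $E$ of idempotents is finite. A pair $\{e,f\}$ of elements of $E$ is called basic if $\{e,f\}\cap\{ef,fe\}\neq\varnothing$; in that case $e\ast f:=ef$ is again in $E$, and $\mathcal{E}=(E,\ast)$ is the (finite) biordered set of idempotents of $S$. Let $E^+$ be the free semigroup on $E$ and let $$\mathsf{IG}(\mathcal{E})=\langle\,\overline{E} : \overline{e}\,\overline{f}=\overline{e\ast f}\ \text{whenever } \{e,f\} \text{ is a basic pair}\,\rangle$$ be the free idempotent generated semigroup over $\mathcal{E}$; for $w\in E^+$ let $\overline{w}$ be the element of $\mathsf{IG}(\mathcal{E})$ that $w$ represents. An r-factorisation of $w\in E^+$ is a factorisation $w=w_1\cdots w_m$ ($m\ge 1$, $w_i\in E^+$) such that every $\overline{w_i}$ is a regular element of $\mathsf{IG}(\mathcal{E})$, i.e. $\overline{w_i}\,x\,\overline{w_i}=\overline{w_i}$ for some $x\in\mathsf{IG}(\mathcal{E})$. A factorisation $(p_1,\dots,p_m)$ of $w$ is coarser than a factorisation $(q_1,\dots,q_s)$ of $w$ if each $p_i$ is the product of the $i$-th block in some partition of $(q_1,\dots,q_s)$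 into $m$ non-empty consecutive blocks. An r-factorisation of $w$ is minimal if no other r-factorisation of $w$ is coarser than it. On non-empty finite sequences of words from $E^+$ define $(p_1,\dots,p_m)\approx(q_1,\dots,q_s)$ if $m=s$ and one of the following holds: (i) $\overline{p_i}=\overline{q_i}$ for some $1\le i\le m$, and $p_j=q_j$ for all $j\ne i$; (ii) $\overline{p_i}=\overline{q_ie}$ and $\overline{q_{i+1}}=\overline{ep_{i+1}}$ for some $1\le i<m$ and $e\in E$, and $p_j=q_j$ for all $j\notin\{i,i+1\}$; (iii) $\overline{q_i}=\overline{p_ie}$ and $\overline{p_{i+1}}=\overline{eq_{i+1}}$ for some $1\le i<m$ and $e\in E$, and $p_j=q_j$ for all $j\notin\{i,i+1\}$. Let $\sim$ be the transitive closure of $\approx$. Theorem. For all $u,v\in E^+$ the following conditions are equivalent: (1) $\overline{u}=\overline{v}$ in $\mathsf{IG}(\mathcal{E})$; (2) there exist minimal r-factorisations $u=p_1\cdots p_m$ and $v=q_1\cdots q_m$ with the same number $m\ge 1$ of factors such that $(p_1,\dots,p_m)\sim(q_1,\dots,q_m)$; (3) there exists an integer $m\ge 1$ such that all minimal r-factorisations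 of $u$ and of $v$ have precisely $m$ factors, and whenever $u=p_1\cdots p_m$ and $v=q_1\cdots q_m$ are minimal r-factorisations, $(p_1,\dots,p_m)\sim(q_1,\dots,q_m)$. -/

import Mathlib

namespace FreeIG

/-- The set `E` of idempotents of a semigroup `S`. -/
abbrev Idem (S : Type*) [Semigroup S] : Type _ := {e : S // IsIdempotentElem e}

/-- `{e, f}` is a basic pair: `{e, f} ∩ {ef, fe} ≠ ∅`. -/
def BasicPair {S : Type*} [Semigroup S] (e f : Idem S) : Prop :=
  (({e.1, f.1} : Set S) ∩ {e.1 * f.1, f.1 * e.1}).Nonempty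

/-- The product in `S` of a basic pair is idempotent. -/
theorem BasicPair.isIdempotentElem_mul {S : Type*} [Semigroup S] {e f : Idem S}
    (h : BasicPair e f) : IsIdempotentElem (e.1 * f.1) := by
  obtain ⟨e, he⟩ := e
  obtain ⟨f, hf⟩ := f
  obtain ⟨x, hx, hx'⟩ := h
  simp only [Set.mem_insert_iff, Set.mem_singleton_iff] at hx hx'
  simp only [IsIdempotentElem] at he hf ⊢
  rcases hx with rfl | rfl <;> rcases hx' with h | h
  · rw [← h, he]
  · calc x * f * (x * f) = x * (f * x) * f := by simp only [mul_assoc]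
      _ = x * f := by rw [← h, he]
  · rw [← h, hf]
  · calc e * x * (e * x) = e * (x * e) * x := by simp only [mul_assoc]
      _ = e * x := by rw [← h, mul_assoc, hf]

/-- The partial operation `e ∗ f` of the biordered set of idempotents of `S`,
defined on basic pairs. -/
def BasicPair.star {S : Type*} [Semigroup S] {e f : Idem S} (h : BasicPair e f) : Idem S :=
  ⟨e.1 * f.1, h.isIdempotentElem_mul⟩

/-- Words over `E`, that is, elements of the free semigroup `E⁺`. -/
abbrev Word (S : Type*) [Semigroup S] : Type _ := FreeSemigroup (Idem S)

/-- The defining relations of `IG(E)`: `e f = e ∗ f` for each basic pair `{e, f}`. -/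
inductive DefRel (S : Type*) [Semigroup S] : Word S → Word S → Prop
  | basic {e f : Idem S} (h : BasicPair e f) :
      DefRel S (FreeSemigroup.of e * FreeSemigroup.of f) (FreeSemigroup.of h.star)

/-- The free idempotent generated semigroup over the biordered set of idempotents of `S`: the
quotient of `E⁺` by the congruence generated by the defining relations. -/
abbrev IG (S : Type*) [Semigroup S] : Type _ := (conGen (DefRel S)).Quotient

/-- The natural homomorphism `w ↦ w̄` from `E⁺` onto `IG(E)`. -/
def bar {S : Type*} [Semigroup S] : Word S →ₙ* IG S where
  toFun w := (w : (conGen (DefRel S)).Quotient)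
  map_mul' _ _ := rfl

/-- Regular elements of a semigroup (in the sense of von Neumann). -/
def IsRegularElement {T : Type*} [Semigroup T] (a : T) : Prop := ∃ x : T, a * x * a = a

/-- The list of letters of a word. -/
def letters {S : Type*} [Semigroup S] (w : Word S) : List (Idem S) := w.head :: w.tail

/-- `w = p₁ ⋯ pₘ` in `E⁺`. As `w` and all the `pᵢ` are nonempty words, `m ≥ 1` is automatic. -/
def IsFactorisation {S : Type*} [Semigroup S] (p : List (Word S)) (w : Word S) : Prop :=
  (p.map letters).flatten = letters w

/-- An r-factorisation of `w`: every factor represents a regular element of `IG(E)`. -/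
def IsRFactorisation {S : Type*} [Semigroup S] (p : List (Word S)) (w : Word S) : Prop :=
  IsFactorisation p w ∧ ∀ x ∈ p, IsRegularElement (bar x)

/-- `(p₁, …, pₘ) ⪯ (q₁, …, qₛ)`: the sequence `q` can be cut into `m` consecutive
(automatically nonempty) blocks such that `pᵢ` is the product of the `i`-th block. -/
def Coarser {S : Type*} [Semigroup S] (p q : List (Word S)) : Prop :=
  ∃ blocks : List (List (Word S)),
    blocks.flatten = q ∧ List.Forall₂ (fun x block => IsFactorisation block x) p blocks

/-- A minimal r-factorisation of `w`: a minimal element, with respect to `⪯`, of the set of all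
r-factorisations of `w`. -/
def IsMinRFactorisation {S : Type*} [Semigroup S] (p : List (Word S)) (w : Word S) : Prop :=
  IsRFactorisation p w ∧ ∀ q, IsRFactorisation q w → Coarser q p → q = p

/-- The relation `≈` on nonempty finite sequences of words. -/
inductive Approx {S : Type*} [Semigroup S] : List (Word S) → List (Word S) → Prop
  | replace (l r : List (Word S)) (a b : Word S) (h : bar a = bar b) :
      Approx (l ++ a :: r) (l ++ b :: r)
  | moveRight (l r : List (Word S)) (a b c d : Word S) (e : Idem S)
      (h₁ : bar a = bar (c * FreeSemigroup.of e))
      (h₂ : bar d = bar (FreeSemigroup.of e * b)) :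
      Approx (l ++ a :: b :: r) (l ++ c :: d :: r)
  | moveLeft (l r : List (Word S)) (a b c d : Word S) (e : Idem S)
      (h₁ : bar c = bar (a * FreeSemigroup.of e))
      (h₂ : bar b = bar (FreeSemigroup.of e * d)) :
      Approx (l ++ a :: b :: r) (l ++ c :: d :: r)

/-- The relation `∼`, the transitive closure of `≈`. -/
def Sim {S : Type*} [Semigroup S] : List (Word S) → List (Word S) → Prop :=
  Relation.TransGen Approx

end FreeIG

/-! Everything rests on seeds. A word has a seed if it is `xey` with a letter `e` such that `xe 𝓛 e
𝓡 ey` in `IG(E)` with an identity adjoined. A defining relation neither creates nor destroys the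
property of having a seed (`Step.hasSeed`, `Step.hasSeed_symm`), and a word represents a regular
element exactly when it has one (`isRegularElement_bar_iff`).

Call a sequence of words with seeds reduced if no adjacent `a, b` satisfy `a 𝓡 ab` or `b 𝓛 ab`. If
one of these relations holds, `ab` has a seed and the two can be merged; if neither ever holds, no
block of two or more consecutive members spells a word with a seed. Hence minimal r-factorisations
are the reduced ones.

Reducedness survives rewriting. A relation inside a factor only respells it. A relation `ef → e∗f`
across a cut forces the seed of one neighbour away from the cut, so that one letter can change sides
by a move of `≈` (`IsReduced.step`). Two reduced factorisations of one word differ by such moves as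
well (`IsReduced.linked`). So reduced factorisations of equal elements are `∼`-related, have equal
length, and have `𝓙`-related factors in corresponding positions.

Finiteness of `E` enters only in proving that regular words have seeds. It excludes bicyclic
behaviour in `S`, which gives a stability property of words with seeds. If `w = wtw`, a reduced
factorisation of `w` is compared with one of `wtw`; stability and the `𝓙`-relations leave room for
only one factor. -/

namespace FreeIG

/-! ### Words and their values in `IG(E)` with an identity adjoined. -/

variable {S : Type*} [Semigroup S]

/-- The image of a word in `IG(E)` with an identity adjoined. -/
def val (w : Word S) : WithOne (IG S) := ((bar w : IG S) : WithOne (IG S))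

/-- The generator of `IG(E)` given by an idempotent. -/
def gen (e : Idem S) : WithOne (IG S) := val (FreeSemigroup.of e)

/-- The image of a possibly empty word in `IG(E)` with an identity adjoined. -/
def eval (l : List (Idem S)) : WithOne (IG S) := (l.map gen).prod

theorem val_mul (a b : Word S) : val (a * b) = val a * val b := by
  simp only [val, map_mul, WithOne.coe_mul]

theorem val_eq_iff {a b : Word S} : val a = val b ↔ bar a = bar b := WithOne.coe_inj

@[simp] theorem eval_nil : eval ([] : List (Idem S)) = 1 := rfl

@[simp] theorem eval_cons (e : Idem S) (l : List (Idem S)) :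
    eval (e :: l) = gen e * eval l := by simp [eval]

@[simp] theorem eval_append (l l' : List (Idem S)) : eval (l ++ l') = eval l * eval l' := by
  simp [eval]

@[simp] theorem letters_of (e : Idem S) : letters (FreeSemigroup.of e) = [e] := rfl

@[simp] theorem letters_mul (a b : Word S) : letters (a * b) = letters a ++ letters b := rfl

theorem letters_ne_nil (w : Word S) : letters w ≠ [] := by simp [letters]

theorem letters_injective : Function.Injective (letters (S := S)) := by
  rintro ⟨a, l⟩ ⟨b, l'⟩ h
  simpa [letters] using h

theorem exists_letters_eq {l : List (Idem S)} (h : l ≠ []) : ∃ w : Word S, letters w = l := by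
  cases l with
  | nil => exact absurd rfl h
  | cons a l => exact ⟨⟨a, l⟩, rfl⟩

@[simp] theorem eval_letters (w : Word S) : eval (letters w) = val w := by
  induction w using FreeSemigroup.recOnMul with
  | ih1 x => simp [gen]
  | ih2 x y hx hy => rw [letters_mul, eval_append, hx, hy, val_mul]

theorem exists_eval_eq (a : WithOne (IG S)) : ∃ l : List (Idem S), eval l = a := by
  induction a using WithOne.recOneCoe with
  | one => exact ⟨[], rfl⟩
  | coe a =>
    obtain ⟨w, rfl⟩ := Quotient.exists_rep a
    exact ⟨letters w, eval_letters w⟩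

theorem gen_mul_gen {e f : Idem S} (h : BasicPair e f) : gen e * gen f = gen h.star := by
  rw [gen, gen, ← val_mul]
  exact val_eq_iff.2 ((Con.eq _).2 (ConGen.Rel.of _ _ (.basic h)))

theorem gen_mul_gen_of_eq_left {e f : Idem S} (h : e.1 * f.1 = e.1) :
    gen e * gen f = gen e := by
  have hb : BasicPair e f := ⟨e.1, by simp, by simp [h]⟩
  rw [gen_mul_gen hb]; congr 1; exact Subtype.ext h

theorem gen_mul_gen_of_eq_right {e f : Idem S} (h : e.1 * f.1 = f.1) :
    gen e * gen f = gen f := by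
  have hb : BasicPair e f := ⟨f.1, by simp, by simp [h]⟩
  rw [gen_mul_gen hb]; congr 1; exact Subtype.ext h

@[simp] theorem gen_mul_self (e : Idem S) : gen e * gen e = gen e :=
  gen_mul_gen_of_eq_left e.2

/-- The member of the pair that equals `ef` or `fe` is the one recovered. This dichotomy decides
which letter inherits a seed from `e ∗ f`, and on which side of a cut `e ∗ f` is placed. -/
theorem BasicPair.gen_cases {e f : Idem S} (h : BasicPair e f) :
    gen e * gen f * gen e = gen e ∨ gen f * gen e * gen f = gen f := by
  obtain ⟨x, hx, hx'⟩ := h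
  simp only [Set.mem_insert_iff, Set.mem_singleton_iff] at hx hx'
  rcases hx with rfl | rfl <;> rcases hx' with h | h
  · left; rw [gen_mul_gen_of_eq_left h.symm, gen_mul_self]
  · left; rw [mul_assoc, gen_mul_gen_of_eq_right h.symm, gen_mul_self]
  · right; rw [mul_assoc, gen_mul_gen_of_eq_right h.symm, gen_mul_self]
  · right; rw [gen_mul_gen_of_eq_left h.symm, gen_mul_self]

/-! ### Elementary rewriting steps. -/

/-- One application of a defining relation, on lists of letters. -/
inductive Step : List (Idem S) → List (Idem S) → Prop
  | mk (x y : List (Idem S)) {e f : Idem S} (h : BasicPair e f) :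
      Step (x ++ e :: f :: y) (x ++ h.star :: y)

theorem Step.append_left (z : List (Idem S)) {a b : List (Idem S)} (h : Step a b) :
    Step (z ++ a) (z ++ b) := by
  obtain ⟨x, y, h⟩ := h
  simpa using Step.mk (z ++ x) y h

theorem Step.append_right (z : List (Idem S)) {a b : List (Idem S)} (h : Step a b) :
    Step (a ++ z) (b ++ z) := by
  obtain ⟨x, y, h⟩ := h
  simpa using Step.mk x (y ++ z) h

theorem eqvGen_map {α β : Type*} {r : α → α → Prop} {s : β → β → Prop} (f : α → β)
    (hf : ∀ a b, r a b → s (f a) (f b)) {a b : α} (h : Relation.EqvGen r a b) :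
    Relation.EqvGen s (f a) (f b) := by
  induction h with
  | rel x y h => exact .rel _ _ (hf _ _ h)
  | refl x => exact .refl _
  | symm x y _ ih => exact .symm _ _ ih
  | trans x y z _ _ ih ih' => exact .trans _ _ _ ih ih'

theorem eqvGen_step_of_bar_eq {u v : Word S} (h : bar u = bar v) :
    Relation.EqvGen Step (letters u) (letters v) := by
  have h' : ConGen.Rel (DefRel S) u v := (Con.eq _).1 h
  clear h
  induction h' with
  | of x y h =>
    obtain ⟨h⟩ := h
    exact .rel _ _ (by simpa using Step.mk [] [] h)
  | refl x => exact .refl _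
  | symm _ ih => exact .symm _ _ ih
  | trans _ _ ih ih' => exact .trans _ _ _ ih ih'
  | mul _ _ ih ih' =>
    rw [letters_mul, letters_mul]
    exact .trans _ _ _ (eqvGen_map (· ++ _) (fun _ _ h => h.append_right _) ih)
      (eqvGen_map (_ ++ ·) (fun _ _ h => h.append_left _) ih')

theorem Step.eval_eq {a b : List (Idem S)} (h : Step a b) : eval a = eval b := by
  obtain ⟨x, y, h⟩ := h
  simp [← gen_mul_gen h, mul_assoc]

/-! ### Seeds and their invariance under rewriting. -/

/-- `a e 𝓛 e`. -/
def LeftAbsorbs (a : WithOne (IG S)) (e : Idem S) : Prop := ∃ r, r * (a * gen e) = gen e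

/-- `e 𝓡 e b`. -/
def RightAbsorbs (e : Idem S) (b : WithOne (IG S)) : Prop := ∃ r, gen e * b * r = gen e

/-- The list `l` of letters has a seed: a letter `e` with `l = xey` and `xe 𝓛 e 𝓡 ey`. -/
def HasSeed (l : List (Idem S)) : Prop :=
  ∃ x e y, l = x ++ e :: y ∧ LeftAbsorbs (eval x) e ∧ RightAbsorbs e (eval y)

theorem append_cons_eq_append_cons {α : Type*} {x y x' y' : List α} {e s : α}
    (h : x ++ e :: y = x' ++ s :: y') :
    (∃ c, x' = x ++ e :: c ∧ y = c ++ s :: y') ∨ (x' = x ∧ s = e ∧ y' = y) ∨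
      ∃ c, x = x' ++ s :: c ∧ y' = c ++ e :: y := by
  rcases List.append_eq_append_iff.1 h with ⟨c, rfl, hc⟩ | ⟨c, rfl, hc⟩
  · cases c with
    | nil =>
      simp only [List.nil_append, List.cons.injEq] at hc
      exact .inr (.inl ⟨by simp, hc.1.symm, hc.2.symm⟩)
    | cons c1 c =>
      simp only [List.cons_append, List.cons.injEq] at hc
      obtain ⟨rfl, rfl⟩ := hc
      exact .inl ⟨c, rfl, rfl⟩
  · cases c with
    | nil =>
      simp only [List.nil_append, List.cons.injEq] at hc
      exact .inr (.inl ⟨by simp, hc.1, hc.2⟩)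
    | cons c1 c =>
      simp only [List.cons_append, List.cons.injEq] at hc
      obtain ⟨rfl, rfl⟩ := hc
      exact .inr (.inr ⟨c, rfl, rfl⟩)

/-- A seed outside the rewritten pair stays a seed, since the context keeps its value; a seed inside
the pair is replaced by `e ∗ f`. -/
theorem Step.hasSeed {a b : List (Idem S)} (h : Step a b) (ha : HasSeed a) : HasSeed b := by
  obtain ⟨x, y, h⟩ := h
  rename_i e f
  obtain ⟨x', s, y', hs, ⟨r, hr⟩, t, ht⟩ := ha
  have hg := gen_mul_gen h
  rcases append_cons_eq_append_cons hs with ⟨c, rfl, hc⟩ | ⟨rfl, rfl, rfl⟩ | ⟨c, rfl, rfl⟩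
  · cases c with
    | nil =>
      simp only [List.nil_append, List.cons.injEq] at hc
      obtain ⟨rfl, rfl⟩ := hc
      refine ⟨x, h.star, y, rfl, ⟨gen h.star * r, ?_⟩, t, ?_⟩
      · simp only [eval_append, eval_cons, eval_nil, mul_one, mul_assoc] at hr
        simp only [← hg, mul_assoc]
        rw [hr, gen_mul_self]
      · rw [← hg, mul_assoc, mul_assoc, ← mul_assoc (gen f), ht]
    | cons c1 c =>
      simp only [List.cons_append, List.cons.injEq] at hc
      obtain ⟨rfl, rfl⟩ := hc
      refine ⟨x ++ h.star :: c, s, y', by simp, ⟨r, ?_⟩, t, ht⟩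
      simpa [← hg, mul_assoc] using hr
  · refine ⟨x', h.star, y, rfl, ⟨r, ?_⟩, t * gen h.star, ?_⟩
    · rw [← hg, ← mul_assoc (eval x'), ← mul_assoc, hr]
    · simp only [eval_cons, mul_assoc] at ht
      rw [← hg]
      calc gen s * gen f * eval y * (t * (gen s * gen f))
          = gen s * (gen f * (eval y * t)) * (gen s * gen f) := by simp only [mul_assoc]
        _ = gen s * gen f := by rw [ht, ← mul_assoc, gen_mul_self]
  · refine ⟨x', s, c ++ h.star :: y, by simp, ⟨r, hr⟩, t, ?_⟩
    simpa [← hg, mul_assoc] using ht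

/-- The delicate case is the seed `e ∗ f`: it passes to `e` if `efe = e` and to `f` if `fef = f`. -/
theorem Step.hasSeed_symm {a b : List (Idem S)} (h : Step a b) (hb : HasSeed b) :
    HasSeed a := by
  obtain ⟨x, y, h⟩ := h
  rename_i e f
  obtain ⟨x', s, y', hs, ⟨r, hr⟩, t, ht⟩ := hb
  have hg := gen_mul_gen h
  rcases append_cons_eq_append_cons hs with ⟨c, rfl, rfl⟩ | ⟨rfl, rfl, rfl⟩ | ⟨c, rfl, rfl⟩
  · refine ⟨x ++ e :: f :: c, s, y', by simp, ⟨r, ?_⟩, t, ht⟩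
    simpa [← hg, mul_assoc] using hr
  · rcases h.gen_cases with h' | h' <;> rw [← hg] at hr ht
    · refine ⟨x', e, f :: y', rfl, ⟨r, ?_⟩, t * gen e, ?_⟩
      · calc r * (eval x' * gen e) = r * (eval x' * (gen e * gen f)) * gen e := by
              simp only [mul_assoc]; rw [← mul_assoc (gen e) (gen f), h']
          _ = gen e := by rw [hr, h']
      · rw [eval_cons, ← mul_assoc, ← mul_assoc, ht, h']
    · refine ⟨x' ++ [e], f, y', by simp, ⟨gen f * r, ?_⟩, t, ?_⟩
      · simp only [eval_append, eval_cons, eval_nil, mul_one]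
        rw [mul_assoc, mul_assoc (eval x'), hr, ← mul_assoc, h']
      · calc gen f * eval y' * t = gen f * (gen e * gen f * eval y' * t) := by
              simp only [← mul_assoc]; rw [h']
          _ = gen f := by rw [ht, ← mul_assoc, h']
  · refine ⟨x', s, c ++ e :: f :: y, by simp, ⟨r, hr⟩, t, ?_⟩
    simpa [← hg, mul_assoc] using ht

theorem hasSeed_singleton (e : Idem S) : HasSeed [e] :=
  ⟨[], e, [], rfl, ⟨1, by simp⟩, 1, by simp⟩

/-! ### Green's relations and mergeability in a monoid. -/

section Monoid

variable {M : Type*} [Monoid M]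

/-- `a 𝓡 a b`. -/
def RMerge (a b : M) : Prop := ∃ r, a * b * r = a

/-- `b 𝓛 a b`. -/
def LMerge (a b : M) : Prop := ∃ r, r * (a * b) = b

/-- Neither `a 𝓡 a b` nor `b 𝓛 a b`. -/
def NoMerge (a b : M) : Prop := ¬ RMerge a b ∧ ¬ LMerge a b

/-- Green's relation `𝓡` on a monoid. -/
def GreenR (a b : M) : Prop := (∃ r, a * r = b) ∧ ∃ r, b * r = a

/-- Green's relation `𝓛` on a monoid. -/
def GreenL (a b : M) : Prop := (∃ r, r * a = b) ∧ ∃ r, r * b = a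

/-- Green's relation `𝓙` on a monoid. -/
def GreenJ (a b : M) : Prop := (∃ r s, r * a * s = b) ∧ ∃ r s, r * b * s = a

theorem GreenR.refl (a : M) : GreenR a a := ⟨⟨1, by simp⟩, 1, by simp⟩

theorem GreenJ.symm {a b : M} (h : GreenJ a b) : GreenJ b a := ⟨h.2, h.1⟩

theorem GreenR.greenJ {a b : M} (h : GreenR a b) : GreenJ a b := by
  obtain ⟨⟨r, h⟩, s, h'⟩ := h
  exact ⟨⟨1, r, by simpa⟩, 1, s, by simpa⟩

theorem GreenL.greenJ {a b : M} (h : GreenL a b) : GreenJ a b := by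
  obtain ⟨⟨r, h⟩, s, h'⟩ := h
  exact ⟨⟨r, 1, by simpa⟩, s, 1, by simpa⟩

theorem GreenJ.refl (a : M) : GreenJ a a := (GreenR.refl a).greenJ

theorem GreenJ.trans {a b c : M} (h : GreenJ a b) (h' : GreenJ b c) : GreenJ a c := by
  obtain ⟨⟨r, s, rfl⟩, t, u, h2⟩ := h
  obtain ⟨⟨r', s', rfl⟩, t', u', h4⟩ := h'
  refine ⟨⟨r' * r, s * s', by simp only [mul_assoc]⟩, t * t', u' * u, ?_⟩
  calc t * t' * (r' * (r * a * s) * s') * (u' * u)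
      = t * (t' * (r' * (r * a * s) * s') * u') * u := by simp only [mul_assoc]
    _ = a := by rw [h4, h2]

theorem RMerge.of_mul {a b c : M} (h : RMerge a (b * c)) : RMerge a b := by
  obtain ⟨r, h⟩ := h
  exact ⟨c * r, by simpa only [mul_assoc] using h⟩

theorem NoMerge.right {z a a' : M} (h : NoMerge z a) (ha : GreenR a a') : NoMerge z a' := by
  obtain ⟨⟨k, rfl⟩, k', hk'⟩ := ha
  refine ⟨fun ⟨r, hr⟩ => h.1 ⟨k * r, by simpa only [mul_assoc] using hr⟩,
    fun ⟨r, hr⟩ => h.2 ⟨r, ?_⟩⟩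
  calc r * (z * a) = r * (z * (a * k)) * k' := by
        rw [mul_assoc r, mul_assoc z, hk']
    _ = a := by rw [hr, hk']

theorem NoMerge.left {z b b' : M} (h : NoMerge b z) (hb : GreenL b b') : NoMerge b' z := by
  obtain ⟨⟨k, rfl⟩, k', hk'⟩ := hb
  refine ⟨fun ⟨r, hr⟩ => h.1 ⟨r, ?_⟩,
    fun ⟨r, hr⟩ => h.2 ⟨r * k, by simpa only [mul_assoc] using hr⟩⟩
  calc b * z * r = k' * (k * b * z * r) := by
        rw [← mul_assoc, ← mul_assoc, hk']
    _ = b := by rw [hr, hk']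

/-- Moving a letter across a cut keeps the product and changes the left factor within its `𝓡`-class
and the right one within its `𝓛`-class. This lemma treats the cut itself; `NoMerge.right` and
`NoMerge.left` treat the two neighbouring cuts. -/
theorem NoMerge.of_mul_eq {a b a' b' : M} (h : NoMerge a b) (ha : GreenR a a')
    (hb : GreenL b b') (hab : a * b = a' * b') : NoMerge a' b' := by
  obtain ⟨-, k, hk⟩ := ha
  obtain ⟨-, m, hm⟩ := hb
  refine ⟨fun ⟨r, hr⟩ => h.1 ⟨r * k, ?_⟩, fun ⟨r, hr⟩ => h.2 ⟨m * r, ?_⟩⟩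
  · rw [← mul_assoc, hab, hr, hk]
  · rw [mul_assoc, hab, hr, hm]

theorem isChain_noMerge_replace {l r : List M} {a b a' b' : M}
    (h : (l ++ a :: b :: r).IsChain NoMerge) (ha : GreenR a a') (hb : GreenL b b')
    (hab : a * b = a' * b') : (l ++ a' :: b' :: r).IsChain NoMerge := by
  rw [List.isChain_append] at h ⊢
  obtain ⟨h1, h2, h3⟩ := h
  rw [List.isChain_cons_cons, List.isChain_cons] at h2 ⊢
  obtain ⟨h4, h5, h6⟩ := h2
  exact ⟨h1, ⟨h4.of_mul_eq ha hb hab, fun y hy => (h5 y hy).left hb, h6⟩,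
    fun x hx y hy => by
      simp only [List.head?_cons, Option.mem_def, Option.some.injEq] at hy h3
      subst hy
      exact (h3 x hx a rfl).right ha⟩

end Monoid

/-! ### Seeds of a product of two words. -/

theorem HasSeed.cases_append {a b : List (Idem S)} (h : HasSeed (a ++ b)) :
    RMerge (eval a) (eval b) ∨
      ∃ x s y, b = x ++ s :: y ∧ LeftAbsorbs (eval a * eval x) s ∧ RightAbsorbs s (eval y) := by
  obtain ⟨x, s, y, hs, hr, ht⟩ := h
  rcases List.append_eq_append_iff.1 hs with ⟨c, rfl, hc⟩ | ⟨c, rfl, hc⟩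
  · exact .inr ⟨c, s, y, hc, by simpa using hr, ht⟩
  · cases c with
    | nil =>
      simp only [List.nil_append] at hc
      exact .inr ⟨[], s, y, hc.symm, by simpa using hr, ht⟩
    | cons c1 c =>
      simp only [List.cons_append, List.cons.injEq] at hc
      obtain ⟨rfl, rfl⟩ := hc
      obtain ⟨t, ht⟩ := ht
      refine .inl ⟨t * eval c, ?_⟩
      simp only [eval_append, eval_cons] at ht ⊢
      calc eval x * (gen s * eval c) * eval b * (t * eval c)
          = eval x * (gen s * (eval c * eval b) * t * eval c) := by simp only [mul_assoc]
        _ = eval x * (gen s * eval c) := by rw [ht]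

/-- The seed of `a` serves for `ab`: cancelling the part before it turns `a 𝓡 ab` into a relation
for the seed. -/
theorem RMerge.hasSeed {a b : List (Idem S)} (h : RMerge (eval a) (eval b)) (ha : HasSeed a) :
    HasSeed (a ++ b) := by
  obtain ⟨x, s, y, rfl, ⟨r, hr⟩, t, ht⟩ := ha
  obtain ⟨k, hk⟩ := h
  refine ⟨x, s, y ++ b, by simp, ⟨r, hr⟩, k * t, ?_⟩
  simp only [eval_append, eval_cons] at hk ⊢
  calc gen s * (eval y * eval b) * (k * t)
      = r * (eval x * gen s) * (eval y * eval b) * (k * t) := by rw [hr]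
    _ = r * (eval x * (gen s * eval y) * eval b * k) * t := by simp only [mul_assoc]
    _ = r * (eval x * gen s) * eval y * t := by rw [hk]; simp only [mul_assoc]
    _ = gen s := by rw [hr, ht]

theorem LMerge.hasSeed {a b : List (Idem S)} (h : LMerge (eval a) (eval b)) (hb : HasSeed b) :
    HasSeed (a ++ b) := by
  obtain ⟨x, s, y, rfl, ⟨r, hr⟩, t, ht⟩ := hb
  obtain ⟨k, hk⟩ := h
  refine ⟨a ++ x, s, y, by simp, ⟨r * k, ?_⟩, t, ht⟩
  simp only [eval_append, eval_cons] at hk ⊢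
  calc r * k * (eval a * eval x * gen s)
      = r * k * (eval a * eval x * (gen s * eval y * t)) := by rw [ht]
    _ = r * (k * (eval a * (eval x * (gen s * eval y)))) * t := by simp only [mul_assoc]
    _ = r * (eval x * gen s) * eval y * t := by rw [hk]; simp only [mul_assoc]
    _ = gen s := by rw [hr, ht]

/-! ### Reduced sequences. -/

/-- The word spelled by a sequence of words. -/
def spell (p : List (Word S)) : List (Idem S) := (p.map letters).flatten

@[simp] theorem spell_nil : spell ([] : List (Word S)) = [] := rfl

@[simp] theorem spell_cons (a : Word S) (p : List (Word S)) :
    spell (a :: p) = letters a ++ spell p := rfl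

@[simp] theorem spell_append (p q : List (Word S)) : spell (p ++ q) = spell p ++ spell q := by
  simp [spell]

theorem eval_spell (p : List (Word S)) : eval (spell p) = (p.map val).prod := by
  induction p with
  | nil => rfl
  | cons a p ih => simp [ih]

theorem spell_ne_nil {p : List (Word S)} (hp : p ≠ []) : spell p ≠ [] := by
  cases p with
  | nil => exact absurd rfl hp
  | cons a p => simp [letters_ne_nil]

/-- All members of the sequence have a seed, and no two adjacent ones can be merged. -/
structure IsReduced (p : List (Word S)) : Prop where
  hasSeed : ∀ x ∈ p, HasSeed (letters x)
  isChain : (p.map val).IsChain NoMerge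

theorem IsReduced.tail {a : Word S} {p : List (Word S)} (h : IsReduced (a :: p)) :
    IsReduced p :=
  ⟨fun x hx => h.hasSeed x (List.mem_cons_of_mem _ hx), h.isChain.tail⟩

/-- If `s` lies in the factor `b` and absorbs everything back to `a`, it also absorbs the factor
just before `b`, and then these two adjacent factors could be merged. -/
theorem not_leftAbsorbs_of_isChain {a : Word S} {p : List (Word S)} {x z : List (Idem S)}
    {s : Idem S} (h : ((a :: p).map val).IsChain NoMerge) (hp : spell p = x ++ s :: z) :
    ¬ LeftAbsorbs (val a * eval x) s := by
  rintro ⟨r, hr⟩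
  -- The multiplier `r` must vary: factors lying before the neighbour of `s` are absorbed into it
  -- one by one.
  suffices H : ∀ (p : List (Word S)) (a : Word S) (x : List (Idem S)) (r : WithOne (IG S)),
      ((a :: p).map val).IsChain NoMerge → spell p = x ++ s :: z →
      r * (val a * eval x * gen s) = gen s → False from H p a x r h hp hr
  clear h hp hr
  intro p
  induction p with
  | nil => intro a x r _ hp; simp at hp
  | cons b p ih =>
    intro a x r h hp hr
    simp only [List.map_cons, List.isChain_cons_cons] at h
    rw [spell_cons] at hp
    have key : ∀ c, letters b = x ++ s :: c → False := by
      intro c hc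
      refine h.1.2 ⟨eval x * r, ?_⟩
      rw [← eval_letters b, hc]
      simp only [eval_append, eval_cons]
      calc eval x * r * (val a * (eval x * (gen s * eval c)))
          = eval x * (r * (val a * eval x * gen s) * eval c) := by simp only [mul_assoc]
        _ = eval x * (gen s * eval c) := by rw [hr]
    rcases List.append_eq_append_iff.1 hp with ⟨c, rfl, hc⟩ | ⟨c, hb, hc⟩
    · exact ih b c (r * val a) (by simpa using h.2) hc (by
        simpa [mul_assoc] using hr)
    · cases c with
      | nil =>
        refine ih b [] (r * val a) (by simpa using h.2) (by simpa using hc.symm) ?_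
        rw [List.append_nil] at hb
        simpa [mul_assoc, ← hb] using hr
      | cons c1 c =>
        simp only [List.cons_append, List.cons.injEq] at hc
        obtain ⟨rfl, rfl⟩ := hc
        exact key c hb

/-- A seed in `a` would give `a 𝓡 ab`; a seed further right would absorb everything to its left.
This is what makes reduced factorisations minimal. -/
theorem not_hasSeed_spell {a b : Word S} {p : List (Word S)}
    (h : ((a :: b :: p).map val).IsChain NoMerge) : ¬ HasSeed (spell (a :: b :: p)) := by
  intro hs
  rw [spell_cons] at hs
  rcases hs.cases_append with h' | ⟨x, s, y, hb, hl, -⟩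
  · simp only [List.map_cons, List.isChain_cons_cons] at h
    rw [spell_cons, eval_append, eval_letters, eval_letters] at h'
    exact h.1.1 h'.of_mul
  · exact not_leftAbsorbs_of_isChain h hb (by simpa using hl)

theorem exists_of_spell_eq {p : List (Word S)} {x y : List (Idem S)} {e : Idem S}
    (h : spell p = x ++ e :: y) : ∃ l a r x₁ y₁, p = l ++ a :: r ∧
      letters a = x₁ ++ e :: y₁ ∧ x = spell l ++ x₁ ∧ y = y₁ ++ spell r := by
  induction p generalizing x with
  | nil => simp at h
  | cons b p ih =>
    rw [spell_cons] at h
    have key : ∀ x', x = letters b ++ x' → spell p = x' ++ e :: y →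
        ∃ l a r x₁ y₁, b :: p = l ++ a :: r ∧
          letters a = x₁ ++ e :: y₁ ∧ x = spell l ++ x₁ ∧ y = y₁ ++ spell r := by
      rintro x' rfl h'
      obtain ⟨l, a, r, x₁, y₁, rfl, ha, rfl, rfl⟩ := ih h'
      exact ⟨b :: l, a, r, x₁, y₁, rfl, ha, by simp, rfl⟩
    rcases List.append_eq_append_iff.1 h with ⟨c, hx, hc⟩ | ⟨c, hb, hc⟩
    · exact key c hx hc
    · cases c with
      | nil => exact key [] (by simpa using hb.symm) (by simpa using hc.symm)
      | cons c1 c =>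
        simp only [List.cons_append, List.cons.injEq] at hc
        obtain ⟨rfl, rfl⟩ := hc
        exact ⟨[], b, p, x, c, rfl, hb, by simp, rfl⟩

/-! ### Reduced sequences under rewriting. -/

/-- Sequences of words related by `≈` repeatedly, with `𝓙`-related members. -/
def Linked (p q : List (Word S)) : Prop :=
  Relation.ReflTransGen Approx p q ∧ List.Forall₂ (fun a b => GreenJ (val a) (val b)) p q

theorem Linked.refl (p : List (Word S)) : Linked p p :=
  ⟨.refl, List.forall₂_same.2 fun _ _ => .refl _⟩

theorem forall₂_trans {α : Type*} {R : α → α → Prop} (hR : ∀ a b c, R a b → R b c → R a c)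
    {l m n : List α} (h : List.Forall₂ R l m) (h' : List.Forall₂ R m n) :
    List.Forall₂ R l n := by
  induction h generalizing n with
  | nil => exact h'
  | cons h _ ih => cases h' with
    | cons h1 h2 => exact .cons (hR _ _ _ h h1) (ih h2)

theorem Linked.trans {p q r : List (Word S)} (h : Linked p q) (h' : Linked q r) : Linked p r :=
  ⟨h.1.trans h'.1, forall₂_trans (fun _ _ _ h h' => h.trans h') h.2 h'.2⟩

theorem Approx.symm {p q : List (Word S)} (h : Approx p q) : Approx q p := by
  cases h with
  | replace l r a b h => exact .replace l r b a h.symm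
  | moveRight l r a b c d e h₁ h₂ => exact .moveLeft l r c d a b e h₁ h₂
  | moveLeft l r a b c d e h₁ h₂ => exact .moveRight l r c d a b e h₁ h₂

theorem Approx.cons (z : Word S) {p q : List (Word S)} (h : Approx p q) :
    Approx (z :: p) (z :: q) := by
  cases h with
  | replace l r a b h => exact .replace (z :: l) r a b h
  | moveRight l r a b c d e h₁ h₂ => exact .moveRight (z :: l) r a b c d e h₁ h₂
  | moveLeft l r a b c d e h₁ h₂ => exact .moveLeft (z :: l) r a b c d e h₁ h₂

theorem Approx.eval_spell_eq {p q : List (Word S)} (h : Approx p q) :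
    eval (spell p) = eval (spell q) := by
  cases h with
  | replace l r a b h => simp [val_eq_iff.2 h]
  | moveRight l r a b c d e h₁ h₂ =>
    simp [val_eq_iff.2 h₁, val_eq_iff.2 h₂, val_mul, mul_assoc]
  | moveLeft l r a b c d e h₁ h₂ =>
    simp [val_eq_iff.2 h₁, val_eq_iff.2 h₂, val_mul, mul_assoc]

theorem Linked.symm {p q : List (Word S)} (h : Linked p q) : Linked q p :=
  have : Std.Symm (Approx (S := S)) := ⟨fun _ _ h => h.symm⟩
  ⟨Std.Symm.symm _ _ h.1,
    List.Forall₂.flip (h.2.imp fun _ _ h => h.symm)⟩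

theorem Linked.cons (z : Word S) {p q : List (Word S)} (h : Linked p q) :
    Linked (z :: p) (z :: q) :=
  ⟨h.1.lift (z :: ·) fun _ _ h => h.cons z, .cons (.refl _) h.2⟩

theorem IsReduced.replace {l r : List (Word S)} {a b : Word S} (h : IsReduced (l ++ a :: r))
    (hb : HasSeed (letters b)) (hab : val a = val b) :
    IsReduced (l ++ b :: r) ∧ Linked (l ++ a :: r) (l ++ b :: r) := by
  refine ⟨⟨fun x hx => ?_, ?_⟩, .single (.replace l r a b (val_eq_iff.1 hab)), ?_⟩
  · simp only [List.mem_append, List.mem_cons] at hx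
    rcases hx with hx | rfl | hx
    · exact h.hasSeed x (by simp [hx])
    · exact hb
    · exact h.hasSeed x (by simp [hx])
  · simpa [hab] using h.isChain
  · refine List.rel_append (List.forall₂_same.2 fun _ _ => .refl _) (.cons ?_ ?_)
    · rw [hab]; exact .refl _
    · exact List.forall₂_same.2 fun _ _ => .refl _

theorem IsReduced.replace₂ {l r : List (Word S)} {a b a' b' : Word S}
    (h : IsReduced (l ++ a :: b :: r)) (hsa : HasSeed (letters a')) (hsb : HasSeed (letters b'))
    (ha : GreenR (val a) (val a')) (hb : GreenL (val b) (val b'))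
    (hab : val a * val b = val a' * val b')
    (hA : Relation.ReflTransGen Approx (l ++ a :: b :: r) (l ++ a' :: b' :: r)) :
    IsReduced (l ++ a' :: b' :: r) ∧ Linked (l ++ a :: b :: r) (l ++ a' :: b' :: r) := by
  refine ⟨⟨fun x hx => ?_, ?_⟩, hA, ?_⟩
  · simp only [List.mem_append, List.mem_cons] at hx
    rcases hx with hx | rfl | rfl | hx
    · exact h.hasSeed x (by simp [hx])
    · exact hsa
    · exact hsb
    · exact h.hasSeed x (by simp [hx])
  · have := h.isChain
    simp only [List.map_append, List.map_cons] at this ⊢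
    exact isChain_noMerge_replace this ha hb hab
  · exact List.rel_append (List.forall₂_same.2 fun _ _ => .refl _)
      (.cons ha.greenJ (.cons hb.greenJ (List.forall₂_same.2 fun _ _ => .refl _)))

theorem IsReduced.step_symm {p : List (Word S)} {w : List (Idem S)} (h : IsReduced p)
    (hw : Step w (spell p)) : ∃ q, IsReduced q ∧ spell q = w ∧ Linked p q := by
  generalize hp : spell p = w' at hw
  obtain ⟨x, y, hb⟩ := hw
  rename_i e f
  obtain ⟨l, a, r, x₁, y₁, rfl, ha, rfl, rfl⟩ := exists_of_spell_eq hp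
  obtain ⟨b, hb'⟩ := exists_letters_eq (l := x₁ ++ e :: f :: y₁) (by simp)
  have hst := Step.mk x₁ y₁ hb
  rw [← hb', ← ha] at hst
  have := h.replace (b := b) (hst.hasSeed_symm (h.hasSeed a (by simp)))
    (by rw [← eval_letters, ← eval_letters, hst.eval_eq])
  exact ⟨_, this.1, by simp [hb'], this.2⟩

theorem HasSeed.append_star {x : List (Idem S)} {e f : Idem S} (h : HasSeed (x ++ [e]))
    (hb : BasicPair e f) (hefe : gen e * gen f * gen e = gen e) : HasSeed (x ++ [hb.star]) := by
  have hm : RMerge (eval (x ++ [e])) (eval [f]) := ⟨gen e, by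
    simp only [eval_append, eval_cons, eval_nil, mul_one, mul_assoc] at hefe ⊢
    rw [hefe]⟩
  refine Step.hasSeed (Step.mk x [] hb) ?_
  simpa using hm.hasSeed h

theorem HasSeed.star_cons {y : List (Idem S)} {e f : Idem S} (h : HasSeed (f :: y))
    (hb : BasicPair e f) (hfef : gen f * gen e * gen f = gen f) : HasSeed (hb.star :: y) := by
  have hm : LMerge (eval [e]) (eval (f :: y)) := ⟨gen f, by
    simp only [eval_cons, eval_nil, mul_one, ← mul_assoc] at hfef ⊢
    rw [hfef]⟩
  exact Step.hasSeed (Step.mk [] y hb) (hm.hasSeed h)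

/-- Either the first letter is the seed, or the seed lies in `y` and `f` can be detached without
leaving the `𝓛`-class. -/
theorem HasSeed.rightAbsorbs_or {f : Idem S} {y : List (Idem S)} (h : HasSeed (f :: y)) :
    RightAbsorbs f (eval y) ∨ HasSeed y ∧ LMerge (gen f) (eval y) := by
  obtain ⟨x, s, z, hs, ⟨r, hr⟩, ht⟩ := h
  cases x with
  | nil =>
    simp only [List.nil_append, List.cons.injEq] at hs
    obtain ⟨rfl, rfl⟩ := hs
    exact .inl ht
  | cons c x =>
    simp only [List.cons_append, List.cons.injEq] at hs
    obtain ⟨rfl, rfl⟩ := hs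
    rw [eval_cons] at hr
    refine .inr ⟨⟨x, s, z, rfl, ⟨r * gen f, by simpa only [mul_assoc] using hr⟩, ht⟩,
      eval x * r, ?_⟩
    simp only [eval_append, eval_cons]
    calc eval x * r * (gen f * (eval x * (gen s * eval z)))
        = eval x * (r * (gen f * eval x * gen s)) * eval z := by simp only [mul_assoc]
      _ = eval x * (gen s * eval z) := by rw [hr, mul_assoc]

theorem HasSeed.leftAbsorbs_or {e : Idem S} {x : List (Idem S)} (h : HasSeed (x ++ [e])) :
    LeftAbsorbs (eval x) e ∨ HasSeed x ∧ RMerge (eval x) (gen e) := by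
  rcases h.cases_append with h' | ⟨x', s, y, hs, hr, ht⟩
  · refine (em _).imp_right fun hne => ⟨?_, by simpa using h'⟩
    obtain ⟨x', s, y, hs, hr, t, ht⟩ := h
    rcases append_cons_eq_append_cons hs with ⟨c, -, hc⟩ | ⟨rfl, rfl, -⟩ | ⟨c, rfl, rfl⟩
    · simp at hc
    · exact absurd hr hne
    · refine ⟨x', s, c, rfl, hr, gen e * t, ?_⟩
      simpa [mul_assoc] using ht
  · cases x' with
    | nil =>
      simp only [List.nil_append, List.cons.injEq] at hs
      obtain ⟨rfl, -⟩ := hs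
      exact .inl (by simpa using hr)
    | cons c x' => simp at hs

/-- The essential case is a pair `e`, `f` separated by a cut. If `efe = e`, the letter `f` moves
left to form `e ∗ f`; if `fef = f`, the letter `e` moves right. -/
theorem IsReduced.step {p : List (Word S)} {w : List (Idem S)} (h : IsReduced p)
    (hw : Step (spell p) w) : ∃ q, IsReduced q ∧ spell q = w ∧ Linked p q := by
  generalize hp : spell p = w' at hw
  obtain ⟨x, y, hb⟩ := hw
  rename_i e f
  have hg := gen_mul_gen hb
  obtain ⟨l, a, r, x₁, y₁, rfl, ha, rfl, hy⟩ := exists_of_spell_eq hp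
  cases y₁ with
  | cons c y₁ =>
    simp only [List.cons_append, List.cons.injEq] at hy
    obtain ⟨rfl, rfl⟩ := hy
    obtain ⟨b, hb'⟩ := exists_letters_eq (l := x₁ ++ hb.star :: y₁) (by simp)
    have hst := Step.mk x₁ y₁ hb
    rw [← hb', ← ha] at hst
    have := h.replace (b := b) (hst.hasSeed (h.hasSeed a (by simp)))
      (by rw [← eval_letters, ← eval_letters, hst.eval_eq])
    exact ⟨_, this.1, by simp [hb'], this.2⟩
  | nil =>
    cases r with
    | nil => simp at hy
    | cons b r =>
      obtain ⟨y₁, hbl⟩ : ∃ y₁, letters b = f :: y₁ := ⟨b.tail, by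
        simp only [spell_cons, letters, List.nil_append, List.cons_append,
          List.cons.injEq] at hy
        simp [letters, hy.1]⟩
      simp only [spell_cons, hbl, List.nil_append, List.cons_append, List.cons.injEq,
        true_and] at hy
      subst hy
      have hva : val a = eval x₁ * gen e := by rw [← eval_letters, ha]; simp
      have hvb : val b = gen f * eval y₁ := by rw [← eval_letters, hbl]; simp
      have hsa := h.hasSeed a (by simp)
      have hsb := h.hasSeed b (by simp)
      rw [ha] at hsa
      rw [hbl] at hsb
      have hn : NoMerge (val a) (val b) := by
        have := h.isChain
        simp only [List.map_append, List.map_cons, List.isChain_append,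
          List.isChain_cons_cons] at this
        exact this.2.1.1
      rw [hva, hvb] at hn
      rcases hb.gen_cases with hefe | hfef
      · rcases hsb.rightAbsorbs_or with ⟨t, ht⟩ | ⟨hsy, k, hk⟩
        -- If `f` were the seed of `b`, then `efe = e` would give `a 𝓡 ab`.
        · refine absurd ⟨t * gen e, ?_⟩ hn.1
          calc eval x₁ * gen e * (gen f * eval y₁) * (t * gen e)
              = eval x₁ * (gen e * (gen f * eval y₁ * t) * gen e) := by simp only [mul_assoc]
            _ = eval x₁ * gen e := by rw [ht, hefe]
        · obtain ⟨a', ha'⟩ := exists_letters_eq (l := x₁ ++ [hb.star]) (by simp)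
          obtain ⟨b', hb'⟩ := exists_letters_eq (l := y₁) (by
            rintro rfl; obtain ⟨x, s, y, h, -⟩ := hsy; simp at h)
          have hva' : val a' = val a * gen f := by
            rw [← eval_letters, ha', hva]; simp [← hg, mul_assoc]
          have hvb' : val b = gen f * val b' := by rw [← eval_letters b', hb', hvb]
          have := h.replace₂ (a' := a') (b' := b') (by rw [ha']; exact hsa.append_star hb hefe)
            (by rwa [hb']) ⟨⟨_, hva'.symm⟩, gen e, by
              rw [hva', hva, mul_assoc, mul_assoc, ← mul_assoc (gen e), hefe]⟩
            ⟨⟨k, by rw [← eval_letters b', hb', ← hk, hvb]⟩, _, hvb'.symm⟩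
            (by rw [hva', hvb', mul_assoc])
            (.single (.moveLeft l r a b a' b' f (val_eq_iff.1 (by rw [hva', val_mul]; rfl))
              (val_eq_iff.1 (by rw [hvb', val_mul]; rfl))))
          exact ⟨_, this.1, by simp [ha', hb'], this.2⟩
      · rcases hsa.leftAbsorbs_or with ⟨t, ht⟩ | ⟨hsx, k, hk⟩
        · refine absurd ⟨gen f * t, ?_⟩ hn.2
          calc gen f * t * (eval x₁ * gen e * (gen f * eval y₁))
              = gen f * (t * (eval x₁ * gen e)) * gen f * eval y₁ := by simp only [mul_assoc]
            _ = gen f * eval y₁ := by rw [ht, hfef]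
        · obtain ⟨b', hb'⟩ := exists_letters_eq (l := hb.star :: y₁) (by simp)
          obtain ⟨a', ha'⟩ := exists_letters_eq (l := x₁) (by
            rintro rfl; obtain ⟨x, s, y, h, -⟩ := hsx; simp at h)
          have hvb' : val b' = gen e * val b := by
            rw [← eval_letters, hb', hvb]; simp [← hg, mul_assoc]
          have hva' : val a = val a' * gen e := by rw [← eval_letters a', ha', hva]
          have := h.replace₂ (a' := a') (b' := b') (by rwa [ha'])
            (by rw [hb']; exact hsb.star_cons hb hfef)
            ⟨⟨k, by rw [← eval_letters a', ha', hva, hk]⟩, _, hva'.symm⟩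
            ⟨⟨_, hvb'.symm⟩, gen f, by
              rw [hvb', hvb, ← mul_assoc, ← mul_assoc, hfef]⟩
            (by rw [hva', hvb', mul_assoc])
            (.single (.moveRight l r a b a' b' e (val_eq_iff.1 (by rw [hva', val_mul]; rfl))
              (val_eq_iff.1 (by rw [hvb', val_mul]; rfl))))
          exact ⟨_, this.1, by simp [ha', hb'], this.2⟩

/-- Both directions are carried together so that the symmetry case of the induction is available. -/
theorem IsReduced.exists_of_eqvGen {w w' : List (Idem S)} (h : Relation.EqvGen Step w w') :
    (∀ p : List (Word S), IsReduced p → spell p = w →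
        ∃ q, IsReduced q ∧ spell q = w' ∧ Linked p q) ∧
      ∀ p : List (Word S), IsReduced p → spell p = w' →
        ∃ q, IsReduced q ∧ spell q = w ∧ Linked p q := by
  induction h with
  | rel x y h =>
    exact ⟨by rintro p hp rfl; exact hp.step h, by rintro p hp rfl; exact hp.step_symm h⟩
  | refl x => exact ⟨fun p hp h => ⟨p, hp, h, .refl p⟩, fun p hp h => ⟨p, hp, h, .refl p⟩⟩
  | symm x y _ ih => exact ih.symm
  | trans x y z _ _ ih ih' =>
    constructor
    · intro p hp h
      obtain ⟨q, hq, hqs, hl⟩ := ih.1 p hp h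
      obtain ⟨r, hr, hrs, hl'⟩ := ih'.1 q hq hqs
      exact ⟨r, hr, hrs, hl.trans hl'⟩
    · intro p hp h
      obtain ⟨q, hq, hqs, hl⟩ := ih'.2 p hp h
      obtain ⟨r, hr, hrs, hl'⟩ := ih.2 q hq hqs
      exact ⟨r, hr, hrs, hl.trans hl'⟩

/-! ### Two reduced factorisations of the same word. -/

theorem reflTransGen_approx_move (r : List (Word S)) (d : Word S) (c : List (Idem S))
    (a b a' : Word S) (hb : letters b = c ++ letters d) (ha : letters a' = letters a ++ c) :
    Relation.ReflTransGen Approx (a :: b :: r) (a' :: d :: r) := by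
  induction c generalizing a b with
  | nil =>
    obtain rfl := letters_injective (hb.trans (List.nil_append _))
    obtain rfl := letters_injective (ha.trans (List.append_nil _))
    exact .refl
  | cons e c ih =>
    obtain ⟨b', hb'⟩ := exists_letters_eq (l := c ++ letters d) (by simp [letters_ne_nil])
    have hab : Approx (a :: b :: r) (a * .of e :: b' :: r) := by
      refine .moveLeft [] r a b (a * .of e) b' e rfl ?_
      congr 1
      exact letters_injective (by simp [hb, hb'])
    exact .head hab (ih (a * .of e) b' hb' (by simpa using ha))

/-- The seed of `p₁c` cannot lie in `c`, so `p₁ 𝓡 p₁c`. Since `p₁` and `p₂` cannot be merged, `c` is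
a proper prefix of `p₂ = cd`, the seed of `p₂` lies in `d`, and `c` can cross the cut. -/
theorem IsReduced.exists_move {p₁ q₁ : Word S} {ps : List (Word S)} {c z : List (Idem S)}
    (h : IsReduced (p₁ :: ps)) (hq : HasSeed (letters q₁)) (hc : c ≠ [])
    (hq₁ : letters q₁ = letters p₁ ++ c) (hps : spell ps = c ++ z) :
    ∃ ps', IsReduced (q₁ :: ps') ∧ spell ps' = z ∧ Linked (p₁ :: ps) (q₁ :: ps') := by
  have hvq : val q₁ = val p₁ * eval c := by rw [← eval_letters, hq₁]; simp
  rw [hq₁] at hq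
  rcases hq.cases_append with hm | ⟨x, s, y, rfl, hl, -⟩
  swap
  · exact absurd (by simpa using hl) (not_leftAbsorbs_of_isChain h.isChain
      (x := x) (s := s) (z := y ++ z) (by simpa using hps))
  rw [eval_letters] at hm
  cases ps with
  | nil => simp [hc] at hps
  | cons p₂ ps =>
    have hn : NoMerge (val p₁) (val p₂) := by
      have := h.isChain
      simp only [List.map_cons, List.isChain_cons_cons] at this
      exact this.1
    rw [spell_cons] at hps
    have hcp : ∀ d, c = letters p₂ ++ d → False := by
      rintro d rfl
      rw [eval_append, eval_letters] at hm
      exact hn.1 hm.of_mul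
    rcases List.append_eq_append_iff.1 hps with ⟨d, hd, -⟩ | ⟨d, hd, hz⟩
    · exact (hcp d hd).elim
    · have hd0 : d ≠ [] := by
        rintro rfl
        exact hcp [] (by simpa using hd.symm)
      obtain ⟨d, rfl⟩ := exists_letters_eq hd0
      have hvp : val p₂ = eval c * val d := by rw [← eval_letters, hd]; simp
      have hs₂ := h.hasSeed p₂ (by simp)
      rw [hd] at hs₂
      obtain ⟨k, hk⟩ := hm
      rcases hs₂.cases_append with ⟨t, ht⟩ | ⟨x, s, y, hds, ⟨r, hr⟩, hry⟩
      · refine absurd ⟨t * k, ?_⟩ hn.1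
        rw [eval_letters] at ht
        calc val p₁ * val p₂ * (t * k) = val p₁ * (eval c * val d * t) * k := by
              rw [hvp]; simp only [mul_assoc]
          _ = val p₁ := by rw [ht, hk]
      · have := h.replace₂ (l := []) (a' := q₁) (b' := d) (by rwa [hq₁])
          ⟨x, s, y, hds, ⟨r * eval c, by simpa only [mul_assoc] using hr⟩, hry⟩
          ⟨⟨_, hvq.symm⟩, k, by rw [hvq, hk]⟩
          ⟨⟨eval x * r, by
            rw [hvp, ← eval_letters, hds]
            simp only [eval_append, eval_cons]
            calc eval x * r * (eval c * (eval x * (gen s * eval y)))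
                = eval x * (r * (eval c * eval x * gen s)) * eval y := by simp only [mul_assoc]
              _ = eval x * (gen s * eval y) := by rw [hr, mul_assoc]⟩, _, hvp.symm⟩
          (by rw [hvq, hvp, mul_assoc])
          (reflTransGen_approx_move ps d c p₁ p₂ q₁ hd hq₁)
        exact ⟨_, this.1, by simp [hz], this.2⟩

/-- The shorter first factor is lengthened by `IsReduced.exists_move` until the first factors agree;
the move keeps the number of factors, so induction applies to the tails. -/
theorem IsReduced.linked {p q : List (Word S)} (hp : IsReduced p) (hq : IsReduced q)
    (h : spell p = spell q) : Linked p q := by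
  induction hn : p.length + q.length using Nat.strong_induction_on generalizing p q with
  | _ n ih =>
  cases p with
  | nil =>
    cases q with
    | nil => exact .refl _
    | cons q₁ qs => exact absurd h.symm (spell_ne_nil (by simp))
  | cons p₁ ps =>
    cases q with
    | nil => exact absurd h (spell_ne_nil (by simp))
    | cons q₁ qs =>
      have key : ∀ (p₁ q₁ : Word S) (ps qs : List (Word S)) (c : List (Idem S)),
          IsReduced (p₁ :: ps) → IsReduced (q₁ :: qs) →
          letters q₁ = letters p₁ ++ c → spell ps = c ++ spell qs →
          (p₁ :: ps).length + (q₁ :: qs).length = n → Linked (p₁ :: ps) (q₁ :: qs) := by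
        intro p₁ q₁ ps qs c hp hq hqc hps hn
        by_cases hc : c = []
        · subst hc
          obtain rfl := letters_injective (hqc.trans (List.append_nil _))
          exact (ih _ (by simp only [List.length_cons] at hn; omega) hp.tail hq.tail
            (by simpa using hps) rfl).cons _
        · obtain ⟨ps', h1, h2, h3⟩ := hp.exists_move (hq.hasSeed _ (by simp)) hc hqc hps
          have hlen := h3.2.length_eq
          exact h3.trans ((ih _ (by simp only [List.length_cons] at hn hlen; omega) h1.tail
            hq.tail h2 rfl).cons _)
      rw [spell_cons, spell_cons] at h
      rcases List.append_eq_append_iff.1 h with ⟨c, hc, hs⟩ | ⟨c, hc, hs⟩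
      · exact key _ _ _ _ c hp hq hc hs hn
      · exact (key _ _ _ _ c hq hp hc hs (by omega)).symm

/-! ### Merging down to a reduced sequence. -/

theorem exists_of_not_isChain {α β : Type*} {R : β → β → Prop} {f : α → β} {p : List α}
    (h : ¬ (p.map f).IsChain R) : ∃ l a b r, p = l ++ a :: b :: r ∧ ¬ R (f a) (f b) := by
  induction p with
  | nil => simp at h
  | cons a p ih =>
    cases p with
    | nil => simp at h
    | cons b p =>
      rw [List.map_cons, List.map_cons, List.isChain_cons_cons, not_and_or] at h
      rcases h with h | h
      · exact ⟨[], a, b, p, rfl, h⟩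
      · obtain ⟨l, a', b', r, hp, h⟩ := ih h
        exact ⟨a :: l, a', b', r, by rw [hp]; rfl, h⟩

theorem exists_of_forall₂_append {α β : Type*} {R : α → β → Prop} {l m : List α} {n : List β}
    (h : List.Forall₂ R (l ++ m) n) :
    ∃ n₁ n₂, n = n₁ ++ n₂ ∧ List.Forall₂ R l n₁ ∧ List.Forall₂ R m n₂ := by
  induction l generalizing n with
  | nil => exact ⟨[], n, rfl, .nil, h⟩
  | cons a l ih =>
    cases h with
    | cons h1 h2 =>
      obtain ⟨n₁, n₂, rfl, h3, h4⟩ := ih h2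
      exact ⟨_ :: n₁, n₂, rfl, .cons h1 h3, h4⟩

theorem isFactorisation_iff {p : List (Word S)} {w : Word S} :
    IsFactorisation p w ↔ spell p = letters w := Iff.rfl

theorem Coarser.merge {l r Q : List (Word S)} {a b : Word S}
    (h : Coarser (l ++ a :: b :: r) Q) : Coarser (l ++ (a * b) :: r) Q := by
  obtain ⟨ks, rfl, h⟩ := h
  obtain ⟨k₁, k₂, rfl, h1, h2⟩ := exists_of_forall₂_append h
  cases h2 with
  | cons h3 h2 => cases h2 with
    | @cons _ k _ k' h4 h5 =>
      rename_i c
      refine ⟨k₁ ++ (c ++ k) :: k', by simp, List.rel_append h1 (.cons ?_ h5)⟩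
      rw [isFactorisation_iff] at h3 h4 ⊢
      simp [h3, h4]

theorem Coarser.refl (p : List (Word S)) : Coarser p p :=
  ⟨p.map fun a => [a], by simp [← List.flatMap_def], by
    rw [List.forall₂_map_right_iff]
    exact List.forall₂_same.2 fun _ _ => by simp [IsFactorisation]⟩

theorem Coarser.spell_eq {p q : List (Word S)} (h : Coarser p q) : spell p = spell q := by
  obtain ⟨ks, rfl, h⟩ := h
  induction h with
  | nil => rfl
  | cons h _ ih =>
    rw [isFactorisation_iff] at h
    simp [h, ih]

theorem exists_isReduced_coarser {Q : List (Word S)} (hQ : ∀ x ∈ Q, HasSeed (letters x)) :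
    ∃ q, IsReduced q ∧ Coarser q Q := by
  suffices H : ∀ (n : ℕ) (q : List (Word S)), q.length = n → (∀ x ∈ q, HasSeed (letters x)) →
      Coarser q Q → ∃ q, IsReduced q ∧ Coarser q Q from H _ Q rfl hQ (.refl Q)
  intro n
  induction n with
  | zero =>
    intro q hn hs hc
    obtain rfl := List.length_eq_zero_iff.1 hn
    exact ⟨[], ⟨hs, by simp⟩, hc⟩
  | succ n ih =>
    intro q hn hs hc
    by_cases hch : (q.map val).IsChain NoMerge
    · exact ⟨q, ⟨hs, hch⟩, hc⟩
    · obtain ⟨l, a, b, r, rfl, hm⟩ := exists_of_not_isChain hch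
      refine ih (l ++ (a * b) :: r) (by simp at hn ⊢; omega) (fun x hx => ?_) hc.merge
      simp only [List.mem_append, List.mem_cons] at hx
      rcases hx with hx | rfl | hx
      · exact hs x (by simp [hx])
      · rw [NoMerge, not_and_or, not_not, not_not, ← eval_letters, ← eval_letters] at hm
        rcases hm with hm | hm
        · exact hm.hasSeed (hs a (by simp))
        · exact hm.hasSeed (hs b (by simp))
      · exact hs x (by simp [hx])

/-- The factorisation of a list of letters into single letters. -/
def singles (l : List (Idem S)) : List (Word S) := l.map FreeSemigroup.of

theorem spell_singles (l : List (Idem S)) : spell (singles l) = l := by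
  induction l with
  | nil => rfl
  | cons a l ih => rw [singles, List.map_cons, spell_cons, ← singles, ih]; rfl

theorem hasSeed_of_mem_singles {l : List (Idem S)} {x : Word S} (hx : x ∈ singles l) :
    HasSeed (letters x) := by
  obtain ⟨e, -, rfl⟩ := List.mem_map.1 hx
  exact hasSeed_singleton e

theorem exists_isReduced (l : List (Idem S)) :
    ∃ q : List (Word S), IsReduced q ∧ spell q = l := by
  obtain ⟨q, hq, hc⟩ := exists_isReduced_coarser (Q := singles l)
    fun _ => hasSeed_of_mem_singles
  exact ⟨q, hq, hc.spell_eq.trans (spell_singles l)⟩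

/-! ### Lifting relations from `S`, and finiteness of `E`. -/

/-- The product in `S`, with an identity adjoined, of a possibly empty word. -/
def image (l : List (Idem S)) : WithOne S := (l.map fun e => ((e.1 : S) : WithOne S)).prod

@[simp] theorem image_nil : image ([] : List (Idem S)) = 1 := rfl

@[simp] theorem image_cons (e : Idem S) (l : List (Idem S)) :
    image (e :: l) = (e.1 : WithOne S) * image l := by simp [image]

@[simp] theorem image_append (l l' : List (Idem S)) : image (l ++ l') = image l * image l' := by
  simp [image]

theorem image_eq_of_eval_eq {l l' : List (Idem S)} (hl : l ≠ []) (hl' : l' ≠ [])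
    (h : eval l = eval l') : image l = image l' := by
  obtain ⟨w, rfl⟩ := exists_letters_eq hl
  obtain ⟨w', rfl⟩ := exists_letters_eq hl'
  rw [eval_letters, eval_letters, val_eq_iff] at h
  have h' := eqvGen_step_of_bar_eq h
  generalize letters w = l at h'
  generalize letters w' = l' at h'
  clear * - h'
  induction h' with
  | rel x y h => obtain ⟨x, y, h⟩ := h; simp [BasicPair.star, mul_assoc]
  | refl x => rfl
  | symm x y _ ih => exact ih.symm
  | trans x y z _ _ ih ih' => exact ih.trans ih'

theorem Idem.coe_mul_self (e : Idem S) : (e.1 : WithOne S) * e.1 = e.1 := by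
  rw [← WithOne.coe_mul, e.2.eq]

theorem exists_coe_eq_mul (a : S) (n : WithOne S) : ∃ b : S, (b : WithOne S) = a * n := by
  induction n using WithOne.recOneCoe with
  | one => exact ⟨a, by simp⟩
  | coe n => exact ⟨a * n, by simp⟩

theorem exists_coe_eq_mul' (a : S) (n : WithOne S) : ∃ b : S, (b : WithOne S) = n * a := by
  induction n using WithOne.recOneCoe with
  | one => exact ⟨a, by simp⟩
  | coe n => exact ⟨n * a, by simp⟩

theorem exists_idem_of_coe {n : WithOne S} (b : S) (hb : (b : WithOne S) = n) (h : n * n = n) :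
    ∃ e : Idem S, (e.1 : WithOne S) = n := by
  subst hb
  exact ⟨⟨b, by rwa [← WithOne.coe_mul, WithOne.coe_inj] at h⟩, rfl⟩

/-- A relation `e 𝓡 ez` in `S` lifts to `IG(E)`. -/
theorem rightAbsorbs_of_image {e : Idem S} {z : List (Idem S)} {v : WithOne S}
    (h : (e.1 : WithOne S) * image z * v = e.1) : RightAbsorbs e (eval z) := by
  induction z generalizing e v with
  | nil => exact ⟨1, by simp⟩
  | cons a z ih =>
    rw [image_cons] at h
    -- The idempotent `y = azve` satisfies `ay = y` and `ey = e`. So `{y, a}` is basic, the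
    -- induction hypothesis applies to `ya` and `z`, and `e = ey` carries the result back to `e`.
    obtain ⟨b, hb⟩ := exists_coe_eq_mul a.1 (image z * v * e.1)
    obtain ⟨y, hy⟩ := exists_idem_of_coe b hb (by
      calc (a.1 : WithOne S) * (image z * v * e.1) * (a.1 * (image z * v * e.1))
          = a.1 * image z * v * (e.1 * (a.1 * image z) * v) * e.1 := by simp only [mul_assoc]
        _ = a.1 * (image z * v * e.1) := by
          rw [h]; simp only [mul_assoc]; rw [Idem.coe_mul_self])
    have hay : a.1 * y.1 = y.1 := by
      rw [← WithOne.coe_inj, WithOne.coe_mul, hy, ← mul_assoc, Idem.coe_mul_self]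
    have hey : e.1 * y.1 = e.1 := by
      rw [← WithOne.coe_inj, WithOne.coe_mul, hy, ← mul_assoc, ← mul_assoc, ← mul_assoc,
        mul_assoc (e.1 : WithOne S), h, Idem.coe_mul_self]
    have hb : BasicPair y a := ⟨y.1, by simp, by simp [hay]⟩
    have hg := gen_mul_gen hb
    have hay' := gen_mul_gen_of_eq_right hay
    have hey' := gen_mul_gen_of_eq_left hey
    obtain ⟨r, hr⟩ := ih (e := hb.star) (v := v * e.1 * a.1) (by
      simp only [BasicPair.star, WithOne.coe_mul]
      calc (y.1 : WithOne S) * a.1 * image z * (v * e.1 * a.1)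
          = y.1 * (a.1 * (image z * v * e.1)) * a.1 := by simp only [mul_assoc]
        _ = y.1 * a.1 := by rw [← hy, Idem.coe_mul_self])
    refine ⟨r * gen y, ?_⟩
    rw [← hg] at hr
    rw [eval_cons]
    calc gen e * (gen a * eval z) * (r * gen y)
        = gen e * gen y * (gen a * eval z) * (r * gen y) := by rw [hey']
      _ = gen e * (gen y * gen a * eval z * r) * gen y := by simp only [mul_assoc]
      _ = gen e := by
        rw [hr, mul_assoc, mul_assoc (gen y), hay', gen_mul_self, hey']

/-- A relation `e 𝓛 ze` in `S` lifts to `IG(E)`. -/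
theorem leftAbsorbs_of_image {e : Idem S} {z : List (Idem S)} {v : WithOne S}
    (h : v * (image z * e.1) = e.1) : LeftAbsorbs (eval z) e := by
  induction z using List.reverseRecOn generalizing e v with
  | nil => exact ⟨1, by simp⟩
  | append_singleton z a ih =>
    simp only [image_append, image_cons, image_nil, mul_one] at h
    obtain ⟨b, hb⟩ := exists_coe_eq_mul' a.1 (e.1 * v * image z)
    obtain ⟨y, hy⟩ := exists_idem_of_coe b hb (by
      calc (e.1 : WithOne S) * v * image z * a.1 * (e.1 * v * image z * a.1)
          = e.1 * (v * (image z * a.1 * e.1)) * v * image z * a.1 := by simp only [mul_assoc]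
        _ = e.1 * v * image z * a.1 := by rw [h, Idem.coe_mul_self])
    have hya : y.1 * a.1 = y.1 := by
      rw [← WithOne.coe_inj, WithOne.coe_mul, hy, mul_assoc, Idem.coe_mul_self]
    have hye : y.1 * e.1 = e.1 := by
      rw [← WithOne.coe_inj, WithOne.coe_mul, hy]
      calc (e.1 : WithOne S) * v * image z * a.1 * e.1
          = e.1 * (v * (image z * a.1 * e.1)) := by simp only [mul_assoc]
        _ = e.1 := by rw [h, Idem.coe_mul_self]
    have hb : BasicPair a y := ⟨y.1, by simp, by simp [hya]⟩
    have hg := gen_mul_gen hb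
    have hya' := gen_mul_gen_of_eq_left hya
    have hye' := gen_mul_gen_of_eq_right hye
    obtain ⟨r, hr⟩ := ih (e := hb.star) (v := a.1 * e.1 * v) (by
      simp only [BasicPair.star, WithOne.coe_mul]
      calc (a.1 : WithOne S) * e.1 * v * (image z * (a.1 * y.1))
          = a.1 * (e.1 * v * image z * a.1) * y.1 := by simp only [mul_assoc]
        _ = a.1 * y.1 := by rw [← hy, mul_assoc, Idem.coe_mul_self])
    refine ⟨gen y * r, ?_⟩
    rw [← hg] at hr
    simp only [eval_append, eval_cons, eval_nil, mul_one]
    calc gen y * r * (eval z * gen a * gen e)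
        = gen y * r * (eval z * gen a * (gen y * gen e)) := by rw [hye']
      _ = gen y * (r * (eval z * (gen a * gen y))) * gen e := by simp only [mul_assoc]
      _ = gen e := by
        rw [hr, ← mul_assoc (gen y), hya', gen_mul_self, hye']

/-- Otherwise `a` and `b` would generate a bicyclic monoid with identity `s`. The elements `bᵏaᵏ`
are idempotent, so two of them coincide; multiplying by a power of `a` on the left and of `b` on the
right reduces the coincidence to `bᵏaᵏ = s` for some `k ≥ 1`, which forces `ba = s`. -/
theorem mul_eq_of_mul_eq_of_finite {N : Type*} [Monoid N]
    (hN : {n : N | IsIdempotentElem n}.Finite) {s a b : N} (hsa : s * a = a)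
    (hsb : s * b = b) (has : a * s = a) (hbs : b * s = b) (hab : a * b = s) : b * a = s := by
  have hpow : ∀ k, a ^ (k + 1) * b ^ (k + 1) = s := by
    intro k
    induction k with
    | zero => simpa using hab
    | succ k ih =>
      calc a ^ (k + 1 + 1) * b ^ (k + 1 + 1) = a * (a ^ (k + 1) * b ^ (k + 1)) * b := by
            rw [pow_succ' a, pow_succ b]; simp only [mul_assoc]
        _ = s := by rw [ih, has, hab]
  have hsa' : ∀ k, s * a ^ (k + 1) = a ^ (k + 1) := fun k => by
    rw [pow_succ', ← mul_assoc, hsa]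
  have has' : ∀ k, a ^ (k + 1) * s = a ^ (k + 1) := fun k => by
    rw [pow_succ, mul_assoc, has]
  have hsb' : ∀ k, s * b ^ (k + 1) = b ^ (k + 1) := fun k => by
    rw [pow_succ', ← mul_assoc, hsb]
  have hss : s * s = s := by
    nth_rw 2 [← hab]
    rw [← mul_assoc, hsa, hab]
  have hidem : ∀ k, IsIdempotentElem (b ^ (k + 1) * a ^ (k + 1)) := fun k => by
    rw [IsIdempotentElem, mul_assoc, ← mul_assoc (a ^ (k + 1)), hpow, hsa']
  have hfin : Finite {n : N | IsIdempotentElem n} := hN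
  obtain ⟨i, j, hij, h⟩ := Finite.exists_ne_map_eq_of_infinite
    fun k : ℕ => (⟨_, hidem k⟩ : {n : N | IsIdempotentElem n})
  simp only [Subtype.mk.injEq] at h
  wlog hlt : i < j generalizing i j
  · exact this j i hij.symm h.symm (by omega)
  obtain ⟨d, rfl⟩ := Nat.exists_eq_add_of_lt hlt
  have hb' : b ^ (i + d + 1 + 1) = b ^ (i + 1) * b ^ (d + 1) := by
    rw [← pow_add]; congr 1; omega
  have ha' : a ^ (i + d + 1 + 1) = a ^ (d + 1) * a ^ (i + 1) := by
    rw [← pow_add]; congr 1; omega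
  have hd : b ^ (d + 1) * a ^ (d + 1) = s := by
    calc b ^ (d + 1) * a ^ (d + 1)
        = s * b ^ (d + 1) * (a ^ (d + 1) * s) := by rw [hsb', has']
      _ = a ^ (i + 1) * b ^ (i + 1) * b ^ (d + 1) *
            (a ^ (d + 1) * (a ^ (i + 1) * b ^ (i + 1))) := by rw [hpow]
      _ = a ^ (i + 1) * (b ^ (i + d + 1 + 1) * a ^ (i + d + 1 + 1)) * b ^ (i + 1) := by
        rw [hb', ha']
        simp only [mul_assoc]
      _ = s := by rw [← h, ← mul_assoc, hpow, mul_assoc, hpow, hss]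
  calc b * a = b * (a * s) := by rw [has]
    _ = b * (a * b) * b ^ d * a ^ (d + 1) := by rw [← hd, pow_succ' b]; simp only [mul_assoc]
    _ = s := by rw [hab, hbs, ← pow_succ', hd]

theorem finite_idempotents_withOne [Finite (Idem S)] :
    {n : WithOne S | IsIdempotentElem n}.Finite := by
  refine ((Set.finite_range fun e : Idem S => (e.1 : WithOne S)).insert 1).subset ?_
  intro n hn
  induction n using WithOne.recOneCoe with
  | one => simp
  | coe n =>
    obtain ⟨e, he⟩ := exists_idem_of_coe n rfl hn
    exact .inr ⟨e, he⟩

/-- In `S` the equation reads `(sus)(szvs) = s`. By finiteness the factors also multiply to `s` in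
the other order, so `s 𝓡 sz` in `S`, and this lifts to `IG(E)`. -/
theorem rightAbsorbs_of_eval_eq [Finite (Idem S)] {s : Idem S} {u z v : List (Idem S)}
    (h : gen s = eval (u ++ s :: z ++ v)) : RightAbsorbs s (eval z) := by
  have h' := image_eq_of_eval_eq (l := [s]) (l' := u ++ s :: z ++ v) (by simp) (by simp)
    (by simpa using h)
  simp only [image_append, image_cons, image_nil, mul_one] at h'
  have hs := Idem.coe_mul_self s
  generalize hn : (s.1 : WithOne S) = n at h' hs
  have := mul_eq_of_mul_eq_of_finite finite_idempotents_withOne (s := n)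
    (a := n * image u * n) (b := n * image z * image v * n)
    (by simp only [← mul_assoc, hs]) (by simp only [← mul_assoc, hs])
    (by rw [mul_assoc, hs]) (by rw [mul_assoc, hs]) (by
      calc n * image u * n * (n * image z * image v * n)
          = n * (image u * ((n * n) * image z) * image v) * n := by simp only [mul_assoc]
        _ = n := by rw [hs, ← h', hs, hs])
  refine rightAbsorbs_of_image (v := image v * n * (n * image u * n)) ?_
  rw [hn]
  simpa only [mul_assoc] using this

theorem leftAbsorbs_of_eval_eq [Finite (Idem S)] {s : Idem S} {u z v : List (Idem S)}
    (h : gen s = eval (u ++ (z ++ s :: v))) : LeftAbsorbs (eval z) s := by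
  have h' := image_eq_of_eval_eq (l := [s]) (l' := u ++ (z ++ s :: v)) (by simp) (by simp)
    (by simpa using h)
  simp only [image_append, image_cons, image_nil, mul_one] at h'
  have hs := Idem.coe_mul_self s
  generalize hn : (s.1 : WithOne S) = n at h' hs
  have := mul_eq_of_mul_eq_of_finite finite_idempotents_withOne (s := n)
    (a := n * image u * image z * n) (b := n * image v * n)
    (by simp only [← mul_assoc, hs]) (by simp only [← mul_assoc, hs])
    (by rw [mul_assoc, hs]) (by rw [mul_assoc, hs]) (by
      calc n * image u * image z * n * (n * image v * n)
          = n * (image u * (image z * ((n * n) * image v))) * n := by simp only [mul_assoc]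
        _ = n := by rw [hs, ← h', hs, hs])
  refine leftAbsorbs_of_image (v := n * image v * n * (n * image u)) ?_
  rw [hn]
  simpa only [mul_assoc] using this

/-! ### Regular elements and seeds. -/

/-- Stability: `l 𝓙 lb` implies `l 𝓡 lb`. Cancelling down to the seed reduces this to an equation
for a single idempotent. -/
theorem HasSeed.rMerge_of_mul_eq [Finite (Idem S)] {l : List (Idem S)} (h : HasSeed l)
    {b u v : WithOne (IG S)} (hu : u * (eval l * b) * v = eval l) : RMerge (eval l) b := by
  obtain ⟨x, s, y, rfl, ⟨r, hr⟩, t, ht⟩ := h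
  obtain ⟨u', hu'⟩ := exists_eval_eq (r * u * eval x)
  obtain ⟨b, rfl⟩ := exists_eval_eq b
  obtain ⟨v', hv'⟩ := exists_eval_eq (v * t)
  simp only [eval_append, eval_cons] at hu ⊢
  obtain ⟨k, hk⟩ := rightAbsorbs_of_eval_eq (s := s) (u := u') (z := y ++ b) (v := v') (by
    simp only [eval_append, eval_cons, hu', hv']
    calc gen s = r * (eval x * gen s) * eval y * t := by rw [hr, ht]
      _ = r * (eval x * (gen s * eval y)) * t := by simp only [mul_assoc]
      _ = _ := by rw [← hu]; simp only [mul_assoc])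
  refine ⟨k * eval y, ?_⟩
  rw [eval_append] at hk
  calc eval x * (gen s * eval y) * eval b * (k * eval y)
      = eval x * (gen s * (eval y * eval b) * k) * eval y := by simp only [mul_assoc]
    _ = eval x * (gen s * eval y) := by rw [hk, mul_assoc]

theorem HasSeed.lMerge_of_mul_eq [Finite (Idem S)] {l : List (Idem S)} (h : HasSeed l)
    {b u v : WithOne (IG S)} (hu : u * (b * eval l) * v = eval l) : LMerge b (eval l) := by
  obtain ⟨x, s, y, rfl, ⟨r, hr⟩, t, ht⟩ := h
  obtain ⟨u', hu'⟩ := exists_eval_eq (r * u)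
  obtain ⟨b, rfl⟩ := exists_eval_eq b
  obtain ⟨v', hv'⟩ := exists_eval_eq (eval y * v * t)
  simp only [eval_append, eval_cons] at hu ⊢
  obtain ⟨k, hk⟩ := leftAbsorbs_of_eval_eq (s := s) (u := u') (z := b ++ x) (v := v') (by
    simp only [eval_append, eval_cons, hu', hv']
    calc gen s = r * (eval x * gen s) * eval y * t := by rw [hr, ht]
      _ = r * (eval x * (gen s * eval y)) * t := by simp only [mul_assoc]
      _ = _ := by rw [← hu]; simp only [mul_assoc])
  refine ⟨eval x * k, ?_⟩
  rw [eval_append] at hk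
  calc eval x * k * (eval b * (eval x * (gen s * eval y)))
      = eval x * (k * (eval b * eval x * gen s)) * eval y := by simp only [mul_assoc]
    _ = eval x * (gen s * eval y) := by rw [hk, mul_assoc]

/-- If the block matched with some `x` in `P` had a second member `y`, stability would give `x 𝓡
xy`, against `NoMerge`. So these blocks are singletons, and the last block is `a` followed by all of
`Z`. -/
theorem greenJ_mul_prod_of_flatten_eq {M : Type*} [Monoid M] {P : List M} {a : M}
    {ks : List (List M)} {Z : List M} (hP : (P ++ [a]).IsChain NoMerge)
    (hst : ∀ x ∈ P, ∀ b u v, u * (x * b) * v = x → RMerge x b) (hne : ∀ k ∈ ks, k ≠ [])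
    (hks : ks.flatten = P ++ a :: Z)
    (hJ : List.Forall₂ (fun x k => GreenJ x k.prod) (P ++ [a]) ks) :
    GreenJ a (a * Z.prod) := by
  induction P generalizing ks with
  | nil =>
    cases hJ with
    | cons h1 h2 =>
      cases h2
      simp only [List.flatten_cons, List.flatten_nil, List.append_nil, List.nil_append] at hks
      simpa [hks] using h1
  | cons x P ih =>
    cases hJ with
    | @cons _ k _ ks h1 h2 =>
      rcases k with _ | ⟨x', _ | ⟨y, k⟩⟩
      · exact absurd rfl (hne [] (by simp))
      · simp only [List.flatten_cons, List.cons_append, List.nil_append, List.cons.injEq] at hks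
        exact ih hP.tail (fun x hx => hst x (by simp [hx])) (fun k hk => hne k (by simp [hk]))
          hks.2 h2
      · exfalso
        simp only [List.flatten_cons, List.cons_append, List.cons.injEq] at hks
        obtain ⟨rfl, hks⟩ := hks
        obtain ⟨-, u, v, h⟩ := h1
        have hm := (hst x' (by simp) _ u v (by rw [List.prod_cons] at h; exact h))
        rw [List.prod_cons] at hm
        have hm := hm.of_mul
        cases P with
        | nil =>
          simp only [List.nil_append, List.cons.injEq] at hks
          obtain ⟨rfl, -⟩ := hks
          simp only [List.cons_append, List.nil_append, List.isChain_cons_cons] at hP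
          exact hP.1.1 hm
        | cons z P =>
          simp only [List.cons_append, List.cons.injEq] at hks
          obtain ⟨rfl, -⟩ := hks
          simp only [List.cons_append, List.isChain_cons_cons] at hP
          exact hP.1.1 hm

/-- Suppose `w = wtw` and a reduced factorisation of `w` ends in two factors `b`, `a`. A reduced
factorisation of `wtw`, obtained by merging two copies of it around the letters of `t`, has the same
length and `𝓙`-related factors. Its last factor must then absorb `t` and the whole second copy, so
`a` is `𝓙`-related to a product that has `ba` as a factor. -/
theorem hasSeed_of_isRegularElement [Finite (Idem S)] {w : Word S}
    (h : IsRegularElement (bar w)) : HasSeed (letters w) := by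
  obtain ⟨t, ht⟩ := h
  obtain ⟨t, rfl⟩ : ∃ t' : Word S, bar t' = t := Quotient.exists_rep t
  rw [← map_mul, ← map_mul] at ht
  obtain ⟨p, hp, hpw⟩ := exists_isReduced (letters w)
  obtain ⟨p', a, rfl⟩ : ∃ p' a, p = p' ++ [a] := by
    rcases p.eq_nil_or_concat with rfl | ⟨p', a, rfl⟩
    · exact absurd hpw.symm (letters_ne_nil w)
    · exact ⟨p', a, by simp⟩
  rcases p'.eq_nil_or_concat with rfl | ⟨p'', b, hb⟩
  · have := hp.hasSeed a (by simp)
    simp only [List.nil_append, spell_cons, spell_nil, List.append_nil] at hpw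
    rwa [← hpw]
  · exfalso
    obtain ⟨q, hq, ks, hks, hqk⟩ := exists_isReduced_coarser
      (Q := p' ++ [a] ++ singles (letters t) ++ (p' ++ [a])) (by
        intro x hx
        rw [List.mem_append, List.mem_append] at hx
        rcases hx with (hx | hx) | hx
        · exact hp.hasSeed x hx
        · exact hasSeed_of_mem_singles hx
        · exact hp.hasSeed x hx)
    have hqs : spell q = letters (w * t * w) := by
      rw [Coarser.spell_eq ⟨ks, hks, hqk⟩, spell_append, spell_append, hpw, spell_singles]
      simp
    obtain ⟨q', hq', hqs', hl⟩ :=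
      (IsReduced.exists_of_eqvGen (eqvGen_step_of_bar_eq ht.symm)).1 _ hp hpw
    have hJ := (hl.trans (hq'.linked hq (hqs'.trans hqs.symm))).2
    have hJ' : List.Forall₂ (fun x k => GreenJ x k.prod) (p'.map val ++ [val a])
        (ks.map (List.map val)) := by
      have : List.Forall₂ (fun (x : Word S) (k : List (Word S)) => GreenJ (val x) (k.map val).prod)
          (p' ++ [a]) ks := by
        generalize p' ++ [a] = p at hJ
        clear * - hJ hqk
        induction hJ generalizing ks with
        | nil => cases hqk; exact .nil
        | cons h _ ih =>
          cases hqk with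
          | cons h' hqk =>
            refine .cons ?_ (ih _ hqk)
            rwa [← eval_spell, isFactorisation_iff.1 h', eval_letters]
      rw [← List.map_singleton (f := val), ← List.map_append]
      exact List.forall₂_map_left_iff.2 (List.forall₂_map_right_iff.2 this)
    have hne : ∀ k ∈ ks.map (List.map val), k ≠ [] := by
      intro k hk
      obtain ⟨k', hk', rfl⟩ := List.mem_map.1 hk
      rintro h
      obtain rfl := List.map_eq_nil_iff.1 h
      clear * - hk' hqk
      induction hqk with
      | nil => simp at hk'
      | cons h _ ih =>
        rcases List.mem_cons.1 hk' with rfl | hk'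
        · exact letters_ne_nil _ (isFactorisation_iff.1 h).symm
        · exact ih hk'
    have hfin := greenJ_mul_prod_of_flatten_eq (P := p'.map val) (a := val a)
      (Z := (singles (letters t) ++ (p' ++ [a])).map val) (by simpa using hp.isChain)
      (by
        intro x hx b u v hb
        obtain ⟨x, hx', rfl⟩ := List.mem_map.1 hx
        rw [← eval_letters] at hb ⊢
        exact (hp.hasSeed x (by simp [hx'])).rMerge_of_mul_eq hb)
      hne (by rw [← List.map_flatten, hks]; simp) hJ'
    obtain ⟨-, u, v, huv⟩ := hfin
    -- The second copy of `w` inside the last block ends in `ba`, so stability gives `a 𝓛 ba`.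
    have hlm : LMerge (val b) (val a) := by
      rw [← eval_letters a]
      refine (hp.hasSeed a (by simp)).lMerge_of_mul_eq
        (u := u * (val a * ((singles (letters t)).map val).prod * (p''.map val).prod))
        (v := v) ?_
      rw [eval_letters]
      refine Eq.trans ?_ huv
      simp [hb, mul_assoc]
    have hc := hp.isChain
    simp only [hb, List.concat_eq_append, List.append_assoc, List.cons_append,
      List.nil_append, List.map_append, List.map_cons, List.isChain_append,
      List.isChain_cons_cons] at hc
    exact hc.2.1.1.2 hlm

theorem HasSeed.isRegularElement {w : Word S} (h : HasSeed (letters w)) :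
    IsRegularElement (bar w) := by
  obtain ⟨x, s, y, hw, ⟨r, hr⟩, t, ht⟩ := h
  have hv : val w = eval x * gen s * eval y := by
    rw [← eval_letters, hw, mul_assoc]; simp
  have key : val w * (t * gen s * r) * val w = val w := by
    rw [hv]
    calc eval x * gen s * eval y * (t * gen s * r) * (eval x * gen s * eval y)
        = eval x * (gen s * eval y * t) * gen s * (r * (eval x * gen s)) * eval y := by
          simp only [mul_assoc]
      _ = eval x * gen s * eval y := by
          rw [ht, hr, mul_assoc (eval x), gen_mul_self, mul_assoc (eval x), gen_mul_self]
  obtain ⟨l, hl⟩ := exists_eval_eq t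
  obtain ⟨m, hm⟩ := exists_eval_eq r
  obtain ⟨z, hz⟩ := exists_letters_eq (l := l ++ s :: m) (by simp)
  have hvz : val z = t * gen s * r := by rw [← eval_letters, hz]; simp [hl, hm, mul_assoc]
  rw [← hvz, ← val_mul, ← val_mul, val_eq_iff, map_mul, map_mul] at key
  exact ⟨_, key⟩

theorem isRegularElement_bar_iff [Finite (Idem S)] {w : Word S} :
    IsRegularElement (bar w) ↔ HasSeed (letters w) :=
  ⟨hasSeed_of_isRegularElement, HasSeed.isRegularElement⟩

/-! ### Minimal r-factorisations are the reduced ones. -/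

theorem IsMinRFactorisation.isReduced [Finite (Idem S)] {p : List (Word S)} {w : Word S}
    (h : IsMinRFactorisation p w) : IsReduced p ∧ spell p = letters w := by
  obtain ⟨⟨hw, hr⟩, hmin⟩ := h
  have hs : ∀ x ∈ p, HasSeed (letters x) := fun x hx => isRegularElement_bar_iff.1 (hr x hx)
  obtain ⟨q, hq, hc⟩ := exists_isReduced_coarser hs
  obtain rfl := hmin q ⟨hc.spell_eq.trans hw,
    fun x hx => (hq.hasSeed x hx).isRegularElement⟩ hc
  exact ⟨hq, hw⟩

theorem IsReduced.eq_of_coarser {p q : List (Word S)} (hp : IsReduced p)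
    (hq : ∀ x ∈ q, HasSeed (letters x)) (h : Coarser q p) : q = p := by
  obtain ⟨ks, rfl, h⟩ := h
  have hch := hp.isChain
  clear hp
  induction h with
  | nil => rfl
  | @cons a k q ks h _ ih =>
    rw [isFactorisation_iff] at h
    rcases k with _ | ⟨b, _ | ⟨c, k⟩⟩
    · exact absurd h.symm (letters_ne_nil a)
    · obtain rfl := letters_injective ((List.append_nil _).symm.trans h)
      simp only [List.flatten_cons, List.cons_append, List.nil_append, List.map_cons] at hch ⊢
      rw [← ih (fun x hx => hq x (by simp [hx])) hch.tail]
    · have ha := hq a (by simp)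
      rw [← h] at ha
      refine absurd ha (not_hasSeed_spell ?_)
      rw [List.flatten_cons, List.map_append] at hch
      exact (List.isChain_append.1 hch).1

theorem IsReduced.isMinRFactorisation [Finite (Idem S)] {p : List (Word S)} {w : Word S}
    (h : IsReduced p) (hw : spell p = letters w) : IsMinRFactorisation p w :=
  ⟨⟨hw, fun x hx => (h.hasSeed x hx).isRegularElement⟩, fun _ hq hc =>
    h.eq_of_coarser (fun x hx => isRegularElement_bar_iff.1 (hq.2 x hx)) hc⟩

theorem Sim.eval_spell_eq {p q : List (Word S)} (h : Sim p q) :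
    eval (spell p) = eval (spell q) := by
  induction h with
  | single h => exact h.eval_spell_eq
  | tail _ h ih => exact ih.trans h.eval_spell_eq

theorem Linked.sim {p q : List (Word S)} (h : Linked p q) (hp : p ≠ []) : Sim p q := by
  cases p with
  | nil => exact absurd rfl hp
  -- `∼` is not reflexive by definition; a trivial replacement supplies the one step needed, and it
  -- requires a nonempty sequence.
  | cons a p => exact Relation.TransGen.head' (.replace [] p a a rfl) h.1

end FreeIG

theorem mainTheorem2 {S : Type*} [Semigroup S] [Finite (FreeIG.Idem S)]
    (u v : FreeIG.Word S) :
    List.TFAE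
      [FreeIG.bar u = FreeIG.bar v,
        ∃ p q : List (FreeIG.Word S),
          FreeIG.IsMinRFactorisation p u ∧ FreeIG.IsMinRFactorisation q v ∧
            p.length = q.length ∧ FreeIG.Sim p q,
        ∃ m : ℕ, 1 ≤ m ∧
          (∀ p, FreeIG.IsMinRFactorisation p u → p.length = m) ∧
          (∀ q, FreeIG.IsMinRFactorisation q v → q.length = m) ∧
          ∀ p q, FreeIG.IsMinRFactorisation p u → FreeIG.IsMinRFactorisation q v →
            FreeIG.Sim p q] := by
  open FreeIG in
  obtain ⟨p₀, hp₀, hpu⟩ := exists_isReduced (letters u)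
  obtain ⟨q₀, hq₀, hqv⟩ := exists_isReduced (letters v)
  tfae_have 1 → 3 := by
    intro h
    have key : ∀ p q, IsMinRFactorisation p u → IsMinRFactorisation q v → Linked p q := by
      intro p q hp hq
      obtain ⟨hp, hpw⟩ := hp.isReduced
      obtain ⟨hq, hqw⟩ := hq.isReduced
      obtain ⟨q', hq', hqs, hl⟩ :=
        (IsReduced.exists_of_eqvGen (eqvGen_step_of_bar_eq h)).1 p hp hpw
      exact hl.trans (hq'.linked hq (hqs.trans hqw.symm))
    have hne : ∀ p, IsMinRFactorisation p u → p ≠ [] := by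
      rintro p hp rfl
      exact letters_ne_nil u hp.1.1.symm
    have hp₀' := hp₀.isMinRFactorisation hpu
    have hq₀' := hq₀.isMinRFactorisation hqv
    refine ⟨p₀.length, List.length_pos_iff.2 (hne _ hp₀'), fun p hp => ?_, fun q hq => ?_,
      fun p q hp hq => (key p q hp hq).sim (hne p hp)⟩
    -- Two factorisations of `u` are compared through a fixed one of `v`.
    · exact (key p q₀ hp hq₀').2.length_eq.trans (key p₀ q₀ hp₀' hq₀').2.length_eq.symm
    · exact (key p₀ q hp₀' hq).2.length_eq.symm
  tfae_have 3 → 2 := by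
    rintro ⟨m, -, h1, h2, h3⟩
    have hp₀' := hp₀.isMinRFactorisation hpu
    have hq₀' := hq₀.isMinRFactorisation hqv
    exact ⟨p₀, q₀, hp₀', hq₀', (h1 _ hp₀').trans (h2 _ hq₀').symm, h3 _ _ hp₀' hq₀'⟩
  tfae_have 2 → 1 := by
    rintro ⟨p, q, hp, hq, -, h⟩
    have := h.eval_spell_eq
    rw [hp.isReduced.2, hq.isReduced.2, eval_letters, eval_letters] at this
    exact val_eq_iff.1 this
  tfae_finish
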